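/- Let $\mathbb K=\mathbb R$ or $\mathbb C$, let $\|\cdot\|$ be the Euclidean norm on $\mathbb R^n$, and let $\varphi=\{\varphi_m\}_{m=1}^\infty$ be a family of continuous functions $\varphi_m:\mathbb R^n\to\mathbb R$ such that for every $m\in\mathbb N=\{1,2,\dots\}$ 1) $\displaystyle\lim_{x\to\infty}\frac{\varphi_m(x)}{\|x\|}=+\infty$, and 2) $\displaystyle\lim_{x\to\infty}\bigl(\varphi_m(x)-\varphi_{m+1}(x)\bigr)=+\infty$. For $m\in\mathbb N$ let $\mathcal E(\varphi_m)$ be the normed space of all $\mathbb K$-valued functions $f\in C^m(\mathbb R^n)$ with $$q_m(f)=\sup_{x\in\mathbb R^n,\ |\alpha|\le m}\frac{|D^\alpha f(x)|}{\exp(\varphi_m(x))}<\infty,$$ where $\alpha$ runs over multi-indices, and let $\mathcal E(\varphi)=\bigcap_{m=1}^\infty\mathcal E(\varphi_m)$ carry the projective limit topology, i.e. the coarsest topology making all the inclusions $\mathcal E(\varphi)\to\mathcal E(\varphi_m)$ continuous. Then every polynomial in $n$ variables with coefficients in $\mathbb K$ belongs to $\mathcal E(\varphi)$, and the polynomials are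 dense in $\mathcal E(\varphi)$. -/

import Mathlib

open Filter Topology

noncomputable section

namespace WeightedApprox

/-- The Euclidean space `ℝⁿ`. -/
abbrev Rn (n : ℕ) : Type := EuclideanSpace ℝ (Fin n)

section Derivatives

variable {n : ℕ} {𝕜 : Type*} [RCLike 𝕜]

/-- The partial derivative `∂f/∂xᵢ`. -/
def partialDeriv (i : Fin n) (f : Rn n → 𝕜) : Rn n → 𝕜 :=
  fun x => fderiv ℝ f x (EuclideanSpace.single i 1)

/-- `∂_{i₁}^{α_{i₁}} ⋯ ∂_{i_k}^{α_{i_k}} f` for a list `[i₁, …, i_k]` of coordinates. -/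
def listDeriv (α : Fin n → ℕ) : List (Fin n) → (Rn n → 𝕜) → (Rn n → 𝕜)
  | [], f => f
  | i :: l, f => (partialDeriv i)^[α i] (listDeriv α l f)

/-- `D^α f = ∂₁^{α₁} ⋯ ∂ₙ^{αₙ} f` for a multi-index `α`. -/
def multiDeriv (α : Fin n → ℕ) (f : Rn n → 𝕜) : Rn n → 𝕜 :=
  listDeriv α (List.finRange n) f

theorem multiDeriv_zero (f : Rn n → 𝕜) : multiDeriv (0 : Fin n → ℕ) f = f := by
  have h : ∀ l : List (Fin n), listDeriv (0 : Fin n → ℕ) l f = f := by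
    intro l
    induction l with
    | nil => rfl
    | cons i l ih => simp [listDeriv, ih]
  exact h _

theorem contDiff_partialDeriv (i : Fin n) {f : Rn n → 𝕜} {k : ℕ}
    (hf : ContDiff ℝ ((k + 1 : ℕ) : WithTop ℕ∞) f) :
    ContDiff ℝ (k : WithTop ℕ∞) (partialDeriv i f) :=
  (hf.fderiv_right (m := (k : WithTop ℕ∞)) (by push_cast; exact le_rfl)).clm_apply
    contDiff_const

theorem contDiff_iterate (i : Fin n) (a : ℕ) {f : Rn n → 𝕜} {k : ℕ}
    (hf : ContDiff ℝ ((k + a : ℕ) : WithTop ℕ∞) f) :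
    ContDiff ℝ (k : WithTop ℕ∞) ((partialDeriv i)^[a] f) := by
  induction a generalizing k with
  | zero => simpa using hf
  | succ a ih =>
    rw [Function.iterate_succ_apply']
    refine contDiff_partialDeriv i (ih ?_)
    rwa [show k + 1 + a = k + (a + 1) by ring]

theorem contDiff_listDeriv (α : Fin n → ℕ) (l : List (Fin n)) {f : Rn n → 𝕜} {k : ℕ}
    (hf : ContDiff ℝ ((k + (l.map α).sum : ℕ) : WithTop ℕ∞) f) :
    ContDiff ℝ (k : WithTop ℕ∞) (listDeriv α l f) := by
  induction l generalizing k with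
  | nil => simpa [listDeriv] using hf
  | cons i l ih =>
    refine contDiff_iterate i (α i) (ih ?_)
    rwa [List.map_cons, List.sum_cons, ← add_assoc] at hf

theorem iterate_add_smul (i : Fin n) (a : ℕ) (c : 𝕜) {f g : Rn n → 𝕜}
    (hf : ContDiff ℝ (a : WithTop ℕ∞) f) (hg : ContDiff ℝ (a : WithTop ℕ∞) g) :
    (partialDeriv i)^[a] (f + c • g)
      = (partialDeriv i)^[a] f + c • (partialDeriv i)^[a] g := by
  induction a generalizing f g with
  | zero => rfl
  | succ a ih =>
    have hne : ((a + 1 : ℕ) : WithTop ℕ∞) ≠ 0 := by exact_mod_cast Nat.succ_ne_zero a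
    have h1 : partialDeriv i (f + c • g) = partialDeriv i f + c • partialDeriv i g := by
      funext x
      have hfx := (hf.differentiable hne) x
      have hgx := (hg.differentiable hne) x
      simp only [partialDeriv, Pi.add_apply, Pi.smul_apply]
      rw [fderiv_add hfx (hgx.const_smul c), fderiv_const_smul hgx]
      rfl
    rw [Function.iterate_succ_apply, h1,
      ih (contDiff_partialDeriv i hf) (contDiff_partialDeriv i hg)]
    rfl

theorem listDeriv_add_smul (α : Fin n → ℕ) (l : List (Fin n)) (c : 𝕜) {f g : Rn n → 𝕜}
    (hf : ContDiff ℝ (((l.map α).sum : ℕ) : WithTop ℕ∞) f)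
    (hg : ContDiff ℝ (((l.map α).sum : ℕ) : WithTop ℕ∞) g) :
    listDeriv α l (f + c • g) = listDeriv α l f + c • listDeriv α l g := by
  induction l with
  | nil => rfl
  | cons i l ih =>
    rw [List.map_cons, List.sum_cons] at hf hg
    have hle : (((l.map α).sum : ℕ) : WithTop ℕ∞) ≤ ((α i + (l.map α).sum : ℕ) : WithTop ℕ∞) := by
      exact_mod_cast Nat.le_add_left _ _
    simp only [listDeriv]
    rw [ih (hf.of_le hle) (hg.of_le hle),
      iterate_add_smul i (α i) c (contDiff_listDeriv α l hf) (contDiff_listDeriv α l hg)]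

theorem multiDeriv_add_smul {m : ℕ} (α : Fin n → ℕ) (hα : ∑ i, α i ≤ m) (c : 𝕜)
    {f g : Rn n → 𝕜} (hf : ContDiff ℝ (m : WithTop ℕ∞) f)
    (hg : ContDiff ℝ (m : WithTop ℕ∞) g) :
    multiDeriv α (f + c • g) = multiDeriv α f + c • multiDeriv α g := by
  rw [Fin.sum_univ_def] at hα
  have hle : ((((List.finRange n).map α).sum : ℕ) : WithTop ℕ∞) ≤ (m : WithTop ℕ∞) := by
    exact_mod_cast hα
  exact listDeriv_add_smul α _ c (hf.of_le hle) (hg.of_le hle)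

theorem multiDeriv_zero_fun (α : Fin n → ℕ) : multiDeriv α (0 : Rn n → 𝕜) = 0 := by
  have h := multiDeriv_add_smul (m := ∑ i, α i) α le_rfl (-1 : 𝕜)
    (contDiff_const (c := (0 : 𝕜)) (E := Rn n)) (contDiff_const (c := (0 : 𝕜)) (E := Rn n))
  have e : ((fun _ : Rn n => (0 : 𝕜)) + (-1 : 𝕜) • (fun _ : Rn n => (0 : 𝕜))) = 0 := by
    funext x; simp
  rw [e] at h
  rw [h]
  funext x
  simp

theorem multiDeriv_smul {m : ℕ} (α : Fin n → ℕ) (hα : ∑ i, α i ≤ m) (c : 𝕜)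
    {f : Rn n → 𝕜} (hf : ContDiff ℝ (m : WithTop ℕ∞) f) :
    multiDeriv α (c • f) = c • multiDeriv α f := by
  have h0 : ContDiff ℝ (m : WithTop ℕ∞) (0 : Rn n → 𝕜) := contDiff_const
  have h := multiDeriv_add_smul α hα c h0 hf
  rwa [multiDeriv_zero_fun, zero_add, zero_add] at h

end Derivatives

section Spaces

variable (𝕜 : Type*) [RCLike 𝕜] {n : ℕ}

/-- The vector space of `C^m` functions `f : ℝⁿ → 𝕜` such that
`|D^α f(x)| ≤ C exp (w x)` for some `C` and all `x` and all `|α| ≤ m`. -/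
def weightedSubmodule (m : ℕ) (w : Rn n → ℝ) : Submodule 𝕜 (Rn n → 𝕜) where
  carrier := {f | ContDiff ℝ (m : WithTop ℕ∞) f ∧
    ∃ C : ℝ, ∀ α : Fin n → ℕ, ∑ i, α i ≤ m → ∀ x, ‖multiDeriv α f x‖ / Real.exp (w x) ≤ C}
  zero_mem' := by
    refine ⟨contDiff_const, 0, fun α _ x => ?_⟩
    simp [multiDeriv_zero_fun]
  add_mem' := by
    rintro f g ⟨hf, C, hC⟩ ⟨hg, D, hD⟩
    refine ⟨hf.add hg, C + D, fun α hα x => ?_⟩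
    have h := multiDeriv_add_smul α hα (1 : 𝕜) hf hg
    rw [one_smul, one_smul] at h
    rw [h]
    calc ‖(multiDeriv α f + multiDeriv α g) x‖ / Real.exp (w x)
        ≤ (‖multiDeriv α f x‖ + ‖multiDeriv α g x‖) / Real.exp (w x) := by
          gcongr; exact norm_add_le _ _
      _ ≤ C + D := by
          rw [add_div]; exact add_le_add (hC α hα x) (hD α hα x)
  smul_mem' := by
    rintro c f ⟨hf, C, hC⟩
    refine ⟨contDiff_const.smul hf, ‖c‖ * C, fun α hα x => ?_⟩
    rw [multiDeriv_smul α hα c hf, Pi.smul_apply, norm_smul, mul_div_assoc]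
    exact mul_le_mul_of_nonneg_left (hC α hα x) (norm_nonneg c)

/-- The space `𝓔(w)` of order `m`, as a type of its own (so that it does not inherit the
topology of pointwise convergence from the function space). -/
def WeightedSpace (m : ℕ) (w : Rn n → ℝ) : Type _ := weightedSubmodule 𝕜 m w

variable {𝕜}

/-- `sup { |D^α f(x)| / exp (w x) : x ∈ ℝⁿ, |α| ≤ m }`. -/
def weightedSup (m : ℕ) (w : Rn n → ℝ) (f : Rn n → 𝕜) : ℝ :=
  ⨆ p : {α : Fin n → ℕ // ∑ i, α i ≤ m} × Rn n, ‖multiDeriv p.1.1 f p.2‖ / Real.exp (w p.2)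

theorem bddAbove_weighted {m : ℕ} {w : Rn n → ℝ} {f : Rn n → 𝕜}
    (hf : f ∈ weightedSubmodule 𝕜 m w) :
    BddAbove (Set.range fun p : {α : Fin n → ℕ // ∑ i, α i ≤ m} × Rn n =>
      ‖multiDeriv p.1.1 f p.2‖ / Real.exp (w p.2)) := by
  obtain ⟨-, C, hC⟩ := hf
  refine ⟨C, ?_⟩
  rintro _ ⟨p, rfl⟩
  exact hC _ p.1.2 _

theorem le_weightedSup {m : ℕ} {w : Rn n → ℝ} {f : Rn n → 𝕜}
    (hf : f ∈ weightedSubmodule 𝕜 m w) {α : Fin n → ℕ} (hα : ∑ i, α i ≤ m) (x : Rn n) :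
    ‖multiDeriv α f x‖ / Real.exp (w x) ≤ weightedSup m w f :=
  le_ciSup (bddAbove_weighted hf) (⟨⟨α, hα⟩, x⟩ : {α : Fin n → ℕ // ∑ i, α i ≤ m} × Rn n)

theorem weightedSup_le {m : ℕ} {w : Rn n → ℝ} {f : Rn n → 𝕜} {C : ℝ}
    (h : ∀ α : Fin n → ℕ, ∑ i, α i ≤ m → ∀ x, ‖multiDeriv α f x‖ / Real.exp (w x) ≤ C) :
    weightedSup m w f ≤ C := by
  have : Nonempty ({α : Fin n → ℕ // ∑ i, α i ≤ m} × Rn n) := ⟨⟨⟨0, by simp⟩, 0⟩⟩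
  exact ciSup_le fun p => h _ p.1.2 _

instance (m : ℕ) (w : Rn n → ℝ) : AddCommGroup (WeightedSpace 𝕜 m w) :=
  inferInstanceAs (AddCommGroup (weightedSubmodule 𝕜 m w))

instance (m : ℕ) (w : Rn n → ℝ) : Module 𝕜 (WeightedSpace 𝕜 m w) :=
  inferInstanceAs (Module 𝕜 (weightedSubmodule 𝕜 m w))

/-- The norm `q_m(f) = sup { |D^α f(x)| / exp (w x) : x ∈ ℝⁿ, |α| ≤ m }`. -/
def weightedNorm (m : ℕ) (w : Rn n → ℝ) : AddGroupNorm (WeightedSpace 𝕜 m w) where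
  toFun f := weightedSup m w f.1
  map_zero' := by
    refine le_antisymm (weightedSup_le fun α _ x => ?_) (Real.iSup_nonneg fun p => by positivity)
    change ‖multiDeriv α (0 : Rn n → 𝕜) x‖ / _ ≤ 0
    simp [multiDeriv_zero_fun]
  add_le' f g := by
    refine weightedSup_le fun α hα x => ?_
    have h := multiDeriv_add_smul α hα (1 : 𝕜) f.2.1 g.2.1
    rw [one_smul, one_smul] at h
    change ‖multiDeriv α (f.1 + g.1) x‖ / _ ≤ _
    rw [h]
    calc ‖(multiDeriv α f.1 + multiDeriv α g.1) x‖ / Real.exp (w x)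
        ≤ (‖multiDeriv α f.1 x‖ + ‖multiDeriv α g.1 x‖) / Real.exp (w x) := by
          gcongr; exact norm_add_le _ _
      _ ≤ _ := by
          rw [add_div]; exact add_le_add (le_weightedSup f.2 hα x) (le_weightedSup g.2 hα x)
  neg' f := by
    have key : ∀ (α : Fin n → ℕ), ∑ i, α i ≤ m → ∀ x,
        ‖multiDeriv α (-f.1) x‖ = ‖multiDeriv α f.1 x‖ := by
      intro α hα x
      have h := multiDeriv_smul α hα (-1 : 𝕜) f.2.1
      rw [neg_one_smul, neg_one_smul] at h
      rw [h, Pi.neg_apply, norm_neg]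
    change weightedSup m w (-f.1) = weightedSup m w f.1
    unfold weightedSup
    congr 1
    funext p
    rw [key _ p.1.2]
  eq_zero_of_map_eq_zero' f hf := by
    refine Subtype.ext (funext fun x => ?_)
    have h := le_weightedSup f.2 (α := 0) (by simp) x
    rw [multiDeriv_zero] at h
    have h2 : ‖f.1 x‖ / Real.exp (w x) ≤ 0 := h.trans_eq hf
    have h3 : ‖f.1 x‖ ≤ 0 := by
      have := (div_le_iff₀ (Real.exp_pos (w x))).1 h2
      simpa using this
    exact norm_le_zero_iff.1 h3

/-- The space `𝓔(w)` of order `m` carries the norm topology. -/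
instance (m : ℕ) (w : Rn n → ℝ) : TopologicalSpace (WeightedSpace 𝕜 m w) :=
  (weightedNorm m w).toNormedAddCommGroup.toUniformSpace.toTopologicalSpace

variable (𝕜)

/-- The vector space `𝓔(φ) = ⋂_{m ≥ 1} 𝓔(φ_m)`. -/
def projSubmodule (φ : ℕ+ → Rn n → ℝ) : Submodule 𝕜 (Rn n → 𝕜) :=
  ⨅ m : ℕ+, weightedSubmodule 𝕜 m (φ m)

/-- The space `𝓔(φ) = ⋂_{m ≥ 1} 𝓔(φ_m)`, as a type of its own. -/
def ProjSpace (φ : ℕ+ → Rn n → ℝ) : Type _ := projSubmodule 𝕜 φ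

variable {𝕜}

instance (φ : ℕ+ → Rn n → ℝ) : AddCommGroup (ProjSpace 𝕜 φ) :=
  inferInstanceAs (AddCommGroup (projSubmodule 𝕜 φ))

instance (φ : ℕ+ → Rn n → ℝ) : Module 𝕜 (ProjSpace 𝕜 φ) :=
  inferInstanceAs (Module 𝕜 (projSubmodule 𝕜 φ))

/-- The inclusion `𝓔(φ) ⊆ 𝓔(φ_m)`. -/
def ProjSpace.toWeighted (φ : ℕ+ → Rn n → ℝ) (m : ℕ+) :
    ProjSpace 𝕜 φ →ₗ[𝕜] WeightedSpace 𝕜 m (φ m) :=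
  Submodule.inclusion (iInf_le (fun m : ℕ+ => weightedSubmodule 𝕜 m (φ m)) m)

/-- `𝓔(φ)` carries the projective limit topology: the coarsest topology for which all
the inclusions into the spaces `𝓔(φ_m)` are continuous. -/
instance (φ : ℕ+ → Rn n → ℝ) : TopologicalSpace (ProjSpace 𝕜 φ) :=
  ⨅ m : ℕ+, TopologicalSpace.induced (ProjSpace.toWeighted φ m) inferInstance

/-- The function on `ℝⁿ` given by a polynomial in `n` variables. -/
def polyFun (p : MvPolynomial (Fin n) 𝕜) : Rn n → 𝕜 :=
  fun x => MvPolynomial.eval (fun i => ((x i : ℝ) : 𝕜)) p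

end Spaces

end WeightedApprox

end

/-! Let f lie in the space; membership for every order makes f smooth. Its derivatives of order at
most m are O(exp φ_{m+1}), which by condition 2 is o(exp φ_m). Hence a wide smooth cutoff changes f
little in q_m, and f may be replaced by a compactly supported smooth g
(`exists_compactly_supported_approx`).

Next, g is close to K_t * g for large t, where K_t(x) = t^n K(t x) and K is a normalised power of
sinc ‖x‖. Derivatives fall on g, so uniform convergence handles each of them, and uniform closeness
suffices because φ_m is bounded below (`exists_norm_kconv_scaledKernel_sub_le`).

Finally K_t is replaced by a polynomial. As sinc is even and entire of exponential type, powers of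
its Taylor partial sums approximate K_t with error ε exp(a‖x‖), where a depends on t
(`exists_polynomial_approx_scaledKernel`). Convolution with g preserves this growth
(`exists_norm_kconv_le`), and condition 1 absorbs it into exp φ_m; faster growth would not be
absorbed in general. A polynomial convolved with g is a polynomial (`exists_kconv_eq_polyFun`). -/

namespace WeightedApprox

open MeasureTheory Real
open scoped ContDiff Convolution

/-! ### Iterated partial derivatives indexed by words -/

section Words

variable {n : ℕ} {𝕜 : Type*} [RCLike 𝕜]

/-- The iterated partial derivative along a word of coordinates, the last letter first. -/
noncomputable def wordDeriv (w : List (Fin n)) (f : Rn n → 𝕜) : Rn n → 𝕜 :=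
  w.foldr partialDeriv f

@[simp] theorem wordDeriv_nil (f : Rn n → 𝕜) : wordDeriv [] f = f := rfl

theorem wordDeriv_cons (i : Fin n) (w : List (Fin n)) (f : Rn n → 𝕜) :
    wordDeriv (i :: w) f = partialDeriv i (wordDeriv w f) := rfl

theorem wordDeriv_append (u v : List (Fin n)) (f : Rn n → 𝕜) :
    wordDeriv (u ++ v) f = wordDeriv u (wordDeriv v f) := List.foldr_append

theorem wordDeriv_replicate (a : ℕ) (i : Fin n) (f : Rn n → 𝕜) :
    wordDeriv (List.replicate a i) f = (partialDeriv i)^[a] f := by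
  induction a with
  | zero => rfl
  | succ a ih => rw [List.replicate_succ, wordDeriv_cons, ih, Function.iterate_succ_apply']

theorem contDiff_infty_partialDeriv (i : Fin n) {f : Rn n → 𝕜} (hf : ContDiff ℝ ∞ f) :
    ContDiff ℝ ∞ (partialDeriv i f) :=
  (hf.fderiv_right (m := ∞) le_rfl).clm_apply contDiff_const

theorem contDiff_wordDeriv (w : List (Fin n)) {f : Rn n → 𝕜} (hf : ContDiff ℝ ∞ f) :
    ContDiff ℝ ∞ (wordDeriv w f) := by
  induction w with
  | nil => exact hf
  | cons i w ih => exact contDiff_infty_partialDeriv i ih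

theorem partialDeriv_comm (i j : Fin n) {f : Rn n → 𝕜} (hf : ContDiff ℝ ∞ f) :
    partialDeriv i (partialDeriv j f) = partialDeriv j (partialDeriv i f) := by
  funext x
  have hd : DifferentiableAt ℝ (fderiv ℝ f) x :=
    ((hf.fderiv_right (m := ∞) le_rfl).differentiable (by simp)) x
  have key : ∀ i j : Fin n, partialDeriv i (partialDeriv j f) x
      = fderiv ℝ (fderiv ℝ f) x (EuclideanSpace.single i 1) (EuclideanSpace.single j 1) := by
    intro i j
    unfold partialDeriv
    rw [fderiv_clm_apply hd (differentiableAt_const _)]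
    simp
  have hs : IsSymmSndFDerivAt ℝ f x :=
    hf.contDiffAt.isSymmSndFDerivAt (by
      rw [minSmoothness_of_isRCLikeNormedField]; exact WithTop.coe_le_coe.2 (le_top (a := (2 : ℕ∞))))
  rw [key, key, hs]

theorem wordDeriv_perm {u v : List (Fin n)} (h : u.Perm v) {f : Rn n → 𝕜}
    (hf : ContDiff ℝ ∞ f) : wordDeriv u f = wordDeriv v f := by
  induction h with
  | nil => rfl
  | cons i _ ih => rw [wordDeriv_cons, wordDeriv_cons, ih]
  | swap i j l => exact partialDeriv_comm j i (contDiff_wordDeriv l hf)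
  | trans _ _ h1 h2 => rw [h1, h2]

/-- By commutation the outermost derivative may be applied first, which lets inductions on the word
vary the function. -/
theorem wordDeriv_cons_eq_wordDeriv_partialDeriv (i : Fin n) (w : List (Fin n))
    {f : Rn n → 𝕜} (hf : ContDiff ℝ ∞ f) :
    wordDeriv (i :: w) f = wordDeriv w (partialDeriv i f) := by
  rw [wordDeriv_perm (List.perm_append_singleton i w).symm hf, wordDeriv_append]
  rfl

/-- The word of a multi-index. -/
def indexWord (α : Fin n → ℕ) : List (Fin n) :=
  (List.finRange n).flatMap fun i => List.replicate (α i) i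

theorem multiDeriv_eq_wordDeriv (α : Fin n → ℕ) (f : Rn n → 𝕜) :
    multiDeriv α f = wordDeriv (indexWord α) f := by
  have h : ∀ l : List (Fin n), listDeriv α l f
      = wordDeriv (l.flatMap fun i => List.replicate (α i) i) f := by
    intro l
    induction l with
    | nil => rfl
    | cons i l ih =>
      rw [List.flatMap_cons, wordDeriv_append, wordDeriv_replicate, ← ih]
      rfl
  exact h _

theorem length_indexWord (α : Fin n → ℕ) : (indexWord α).length = ∑ i, α i := by
  rw [indexWord, List.length_flatMap, Fin.sum_univ_def]
  simp

theorem indexWord_count_perm (w : List (Fin n)) :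
    (indexWord fun i => w.count i).Perm w := by
  rw [List.perm_iff_count]
  intro a
  rw [indexWord, List.count_flatMap, ← Fin.sum_univ_def]
  simp [List.count_replicate]

/-- Partial derivatives of a smooth function commute, so only the letter counts matter. Bounds over
|α| ≤ m thus become bounds over words of length at most m, which suit induction. -/
theorem exists_multiDeriv_eq_wordDeriv (w : List (Fin n)) {f : Rn n → 𝕜}
    (hf : ContDiff ℝ ∞ f) :
    ∃ α : Fin n → ℕ, ∑ i, α i = w.length ∧ wordDeriv w f = multiDeriv α f := by
  refine ⟨fun i => w.count i, ?_, ?_⟩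
  · rw [← length_indexWord, (indexWord_count_perm w).length_eq]
  · rw [multiDeriv_eq_wordDeriv, wordDeriv_perm (indexWord_count_perm w) hf]

theorem partialDeriv_add (i : Fin n) {f g : Rn n → 𝕜} (hf : ContDiff ℝ ∞ f)
    (hg : ContDiff ℝ ∞ g) : partialDeriv i (f + g) = partialDeriv i f + partialDeriv i g := by
  funext x
  simp only [partialDeriv, Pi.add_apply]
  rw [fderiv_add (hf.differentiable (by simp) x) (hg.differentiable (by simp) x)]
  rfl

theorem partialDeriv_sub (i : Fin n) {f g : Rn n → 𝕜} (hf : ContDiff ℝ ∞ f)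
    (hg : ContDiff ℝ ∞ g) : partialDeriv i (f - g) = partialDeriv i f - partialDeriv i g := by
  funext x
  simp only [partialDeriv, Pi.sub_apply]
  rw [fderiv_sub (hf.differentiable (by simp) x) (hg.differentiable (by simp) x)]
  rfl

theorem wordDeriv_add (w : List (Fin n)) {f g : Rn n → 𝕜} (hf : ContDiff ℝ ∞ f)
    (hg : ContDiff ℝ ∞ g) : wordDeriv w (f + g) = wordDeriv w f + wordDeriv w g := by
  induction w with
  | nil => rfl
  | cons i w ih =>
    simp only [wordDeriv_cons]
    rw [ih, partialDeriv_add i (contDiff_wordDeriv w hf) (contDiff_wordDeriv w hg)]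

theorem wordDeriv_sub (w : List (Fin n)) {f g : Rn n → 𝕜} (hf : ContDiff ℝ ∞ f)
    (hg : ContDiff ℝ ∞ g) : wordDeriv w (f - g) = wordDeriv w f - wordDeriv w g := by
  induction w with
  | nil => rfl
  | cons i w ih =>
    simp only [wordDeriv_cons]
    rw [ih, partialDeriv_sub i (contDiff_wordDeriv w hf) (contDiff_wordDeriv w hg)]

theorem wordDeriv_eventuallyEq (w : List (Fin n)) {f g : Rn n → 𝕜} {x : Rn n}
    (h : f =ᶠ[𝓝 x] g) : wordDeriv w f =ᶠ[𝓝 x] wordDeriv w g := by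
  induction w with
  | nil => exact h
  | cons i w ih =>
    filter_upwards [ih.fderiv (𝕜 := ℝ)] with y hy
    simp [wordDeriv_cons, partialDeriv, hy]

theorem partialDeriv_smul (i : Fin n) {c : Rn n → ℝ} {f : Rn n → 𝕜} (hc : ContDiff ℝ ∞ c)
    (hf : ContDiff ℝ ∞ f) :
    partialDeriv i (c • f) = partialDeriv i c • f + c • partialDeriv i f := by
  funext x
  simp only [partialDeriv, Pi.add_apply, Pi.smul_apply']
  rw [fderiv_smul (hc.differentiable (by simp) x) (hf.differentiable (by simp) x)]
  simp [add_comm]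

/-- A crude Leibniz rule: each letter splits a product into two, giving 2^|w| terms of size at most
A B. All bounds are needed only at the point x. -/
theorem norm_wordDeriv_smul_le {x : Rn n} {A B : ℝ} (hA : 0 ≤ A) (w : List (Fin n))
    {c : Rn n → ℝ} {f : Rn n → 𝕜} (hc : ContDiff ℝ ∞ c) (hf : ContDiff ℝ ∞ f)
    (hcA : ∀ v : List (Fin n), v.length ≤ w.length → ‖wordDeriv v c x‖ ≤ A)
    (hfB : ∀ v : List (Fin n), v.length ≤ w.length → ‖wordDeriv v f x‖ ≤ B) :
    ‖wordDeriv w (c • f) x‖ ≤ 2 ^ w.length * (A * B) := by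
  induction w generalizing c f with
  | nil =>
    simp only [wordDeriv_nil, Pi.smul_apply', norm_smul, List.length_nil, pow_zero, one_mul]
    exact mul_le_mul (hcA [] le_rfl) (hfB [] le_rfl) (norm_nonneg _) hA
  | cons i w ih =>
    have hci := contDiff_infty_partialDeriv i hc
    have hfi := contDiff_infty_partialDeriv i hf
    rw [wordDeriv_cons_eq_wordDeriv_partialDeriv i w (hc.smul hf), partialDeriv_smul i hc hf,
      wordDeriv_add w (hci.smul hf) (hc.smul hfi)]
    have hle : w.length ≤ (i :: w).length := by simp
    have h1 := ih hci hf
      (fun v hv => by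
        rw [← wordDeriv_cons_eq_wordDeriv_partialDeriv i v hc]; exact hcA _ (by simpa using hv))
      (fun v hv => hfB v (hv.trans hle))
    have h2 := ih hc hfi (fun v hv => hcA v (hv.trans hle))
      (fun v hv => by
        rw [← wordDeriv_cons_eq_wordDeriv_partialDeriv i v hf]; exact hfB _ (by simpa using hv))
    refine (norm_add_le _ _).trans ((add_le_add h1 h2).trans_eq ?_)
    rw [List.length_cons]
    ring

theorem wordDeriv_comp_smul (w : List (Fin n)) (r : ℝ) {f : Rn n → 𝕜} (hf : ContDiff ℝ ∞ f) :
    wordDeriv w (fun x => f (r • x)) = fun x => r ^ w.length • wordDeriv w f (r • x) := by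
  induction w with
  | nil => simp
  | cons i w ih =>
    rw [wordDeriv_cons, ih, wordDeriv_cons]
    funext x
    have hd : DifferentiableAt ℝ (wordDeriv w f) (r • x) :=
      (contDiff_wordDeriv w hf).differentiable (by simp) _
    have h1 : HasFDerivAt (fun y : Rn n => r ^ w.length • wordDeriv w f (r • y))
        (r ^ w.length • ((fderiv ℝ (wordDeriv w f) (r • x)).comp
          (r • ContinuousLinearMap.id ℝ (Rn n)))) x :=
      (hd.hasFDerivAt.comp (f := fun y : Rn n => r • y) x
        ((hasFDerivAt_id x).const_smul r)).const_smul (r ^ w.length)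
    simp only [partialDeriv]
    rw [h1.fderiv]
    simp [pow_succ, smul_smul]

theorem hasCompactSupport_wordDeriv (w : List (Fin n)) {f : Rn n → 𝕜}
    (hf : HasCompactSupport f) : HasCompactSupport (wordDeriv w f) := by
  induction w with
  | nil => exact hf
  | cons i w ih => exact ih.fderiv_apply ℝ _

theorem finite_words (k : ℕ) : {w : List (Fin n) | w.length ≤ k}.Finite :=
  List.finite_length_le _ k

theorem exists_bound_wordDeriv (k : ℕ) {f : Rn n → 𝕜} (hf : ContDiff ℝ ∞ f)
    (hs : HasCompactSupport f) :
    ∃ A, 0 ≤ A ∧ ∀ w : List (Fin n), w.length ≤ k → ∀ x, ‖wordDeriv w f x‖ ≤ A := by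
  have h : ∀ w : List (Fin n), ∃ A, ∀ x, ‖wordDeriv w f x‖ ≤ A := fun w =>
    (hasCompactSupport_wordDeriv w hs).exists_bound_of_continuous (contDiff_wordDeriv w hf).continuous
  choose A hA using h
  obtain ⟨B, hB⟩ := ((finite_words (n := n) k).image A).bddAbove
  refine ⟨max B 0, le_max_right _ _, fun w hw x => (hA w x).trans ?_⟩
  exact (hB ⟨w, hw, rfl⟩).trans (le_max_left _ _)

end Words

/-! ### An integrable kernel of exponential type and its polynomial approximation -/

section Kernel

/-- The partial sums, in the variable `s = r ^ 2`, of the power series of `sinc r`. -/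
noncomputable def sincPartial (j : ℕ) (s : ℝ) : ℝ :=
  ∑ k ∈ Finset.range j, (-1) ^ k / ((2 * k + 1).factorial : ℝ) * s ^ k

theorem hasSum_sinc (r : ℝ) :
    HasSum (fun k : ℕ => (-1) ^ k / ((2 * k + 1).factorial : ℝ) * (r ^ 2) ^ k) (sinc r) := by
  rcases eq_or_ne r 0 with rfl | hr
  · rw [sinc_zero]
    convert hasSum_ite_eq (0 : ℕ) (1 : ℝ) using 2 with k
    rcases k with _ | k <;> simp
  · rw [sinc_of_ne_zero hr]
    refine (congrArg (HasSum · (sin r / r)) (funext fun k => ?_)).mpr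
      ((Real.hasSum_sin r).div_const r)
    rw [← pow_mul, pow_succ r, div_mul_eq_mul_div, div_right_comm, ← mul_assoc,
      mul_div_cancel_right₀ _ hr]

/-- Tail terms are compared with the series of cosh (2 r): doubling the argument gains 4^k, and 1 ≤
2^(-j) 4^k when k ≥ j. -/
theorem abs_sinc_sub_sincPartial_le (j : ℕ) (r : ℝ) :
    |sinc r - sincPartial j (r ^ 2)| ≤ (1 / 2) ^ j * exp (2 * |r|) := by
  set a : ℕ → ℝ := fun k => (-1) ^ k / ((2 * k + 1).factorial : ℝ) * (r ^ 2) ^ k with ha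
  have h1 : HasSum (fun k => a k - if k ∈ Finset.range j then a k else 0)
      (sinc r - sincPartial j (r ^ 2)) := by
    refine (hasSum_sinc r).sub ?_
    have := hasSum_sum_of_ne_finset_zero (f := fun k => if k ∈ Finset.range j then a k else 0)
      (L := SummationFilter.unconditional ℕ) (s := Finset.range j) (fun k hk => by simp only [if_neg hk])
    rwa [Finset.sum_congr rfl fun k hk => if_pos hk] at this
  have h2 := (Real.hasSum_cosh (2 * r)).mul_left ((1 / 2 : ℝ) ^ j)
  have h3 : ‖sinc r - sincPartial j (r ^ 2)‖ ≤ (1 / 2) ^ j * cosh (2 * r) := by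
    refine h1.norm_le_of_bounded h2 fun k => ?_
    split_ifs with hk
    · rw [sub_self, norm_zero]
      have : 0 ≤ (2 * r) ^ (2 * k) := by rw [pow_mul]; positivity
      positivity
    · rw [sub_zero, ha]
      have hk' : j ≤ k := by simpa using hk
      have e1 : ‖(-1) ^ k / ((2 * k + 1).factorial : ℝ) * (r ^ 2) ^ k‖
          = (r ^ 2) ^ k / ((2 * k + 1).factorial : ℝ) := by
        rw [norm_mul, norm_div, norm_pow, norm_neg, norm_one, one_pow, Real.norm_natCast,
          Real.norm_of_nonneg (by positivity)]
        ring
      have e2 : (1 / 2 : ℝ) ^ j * ((2 * r) ^ (2 * k) / ((2 * k).factorial : ℝ))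
          = ((1 / 2) ^ j * 4 ^ k) * ((r ^ 2) ^ k / ((2 * k).factorial : ℝ)) := by
        rw [pow_mul, mul_pow, mul_pow]
        norm_num
        ring
      have e3 : (1 : ℝ) ≤ (1 / 2) ^ j * 4 ^ k := by
        calc (1 : ℝ) = (1 / 2) ^ j * 2 ^ j := by rw [← mul_pow]; norm_num
          _ ≤ (1 / 2) ^ j * 2 ^ k := by gcongr; norm_num
          _ ≤ (1 / 2) ^ j * 4 ^ k := by gcongr; norm_num
      rw [e1, e2]
      have e4 : (r ^ 2) ^ k / ((2 * k + 1).factorial : ℝ)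
          ≤ (r ^ 2) ^ k / ((2 * k).factorial : ℝ) := by
        gcongr
        omega
      refine e4.trans (le_mul_of_one_le_left (by positivity) e3)
  refine h3.trans ?_
  gcongr
  rw [← cosh_abs, abs_mul, abs_two, cosh_eq]
  have : exp (-(2 * |r|)) ≤ exp (2 * |r|) := by gcongr; linarith [abs_nonneg r]
  linarith

/-- From the factorisation of a^M - b^M, both bases being at most 2 exp(2|r|) in absolute value. -/
theorem abs_sinc_pow_sub_le (M j : ℕ) (r : ℝ) :
    |sinc r ^ M - sincPartial j (r ^ 2) ^ M|
      ≤ (1 / 2) ^ j * (M * 2 ^ (M - 1) * exp (2 * M * |r|)) := by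
  rcases Nat.eq_zero_or_pos M with rfl | hM
  · simp
  have h1 := abs_sinc_sub_sincPartial_le j r
  have hE : 1 ≤ exp (2 * |r|) := one_le_exp (by positivity)
  have hs := abs_sinc_le_one r
  have hj : (1 / 2 : ℝ) ^ j ≤ 1 := pow_le_one₀ (by norm_num) (by norm_num)
  have h2 : |sincPartial j (r ^ 2)| ≤ 2 * exp (2 * |r|) := by
    have := abs_sub_abs_le_abs_sub (sincPartial j (r ^ 2)) (sinc r)
    rw [abs_sub_comm] at this
    nlinarith
  have h3 : max |sinc r| |sincPartial j (r ^ 2)| ≤ 2 * exp (2 * |r|) :=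
    max_le (by linarith) h2
  calc |sinc r ^ M - sincPartial j (r ^ 2) ^ M|
      ≤ |sinc r - sincPartial j (r ^ 2)| * M * max |sinc r| |sincPartial j (r ^ 2)| ^ (M - 1) :=
        abs_pow_sub_pow_le _ _ _
    _ ≤ ((1 / 2) ^ j * exp (2 * |r|)) * M * (2 * exp (2 * |r|)) ^ (M - 1) := by gcongr
    _ = (1 / 2) ^ j * (M * 2 ^ (M - 1) * (exp (2 * |r|) ^ (M - 1) * exp (2 * |r|))) := by
        rw [mul_pow]; ring
    _ = _ := by
        rw [← pow_succ, Nat.sub_add_cancel hM, ← exp_nat_mul]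
        ring_nf

/-- Powers of `sinc (t ‖x‖)` are limits of polynomials in a weighted sup-norm with an
exponential weight. -/
theorem exists_polynomial_approx_sinc (n M : ℕ) (t : ℝ) :
    ∃ a, 0 ≤ a ∧ ∀ ε > 0, ∃ P : MvPolynomial (Fin n) ℝ, ∀ x : Rn n,
      |sinc (t * ‖x‖) ^ M - MvPolynomial.eval (fun i => x i) P| ≤ ε * exp (a * ‖x‖) := by
  refine ⟨2 * M * |t|, by positivity, fun ε hε => ?_⟩
  obtain ⟨j, hj⟩ : ∃ j : ℕ, (1 / 2 : ℝ) ^ j * (M * 2 ^ (M - 1)) < ε := by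
    have h : Tendsto (fun j : ℕ => (1 / 2 : ℝ) ^ j * (M * 2 ^ (M - 1))) atTop (𝓝 0) := by
      simpa using (tendsto_pow_atTop_nhds_zero_of_lt_one (r := (1 / 2 : ℝ))
        (by norm_num) (by norm_num)).mul_const ((M : ℝ) * 2 ^ (M - 1))
    exact (h.eventually_lt_const hε).exists
  -- Since sinc is even, its partial sum at t‖x‖ involves only t²‖x‖² = t² ∑ x_i², a polynomial in
  -- x.
  refine ⟨(∑ k ∈ Finset.range j, MvPolynomial.C ((-1) ^ k / ((2 * k + 1).factorial : ℝ)) *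
    (MvPolynomial.C (t ^ 2) * ∑ i, MvPolynomial.X i ^ 2) ^ k) ^ M, fun x => ?_⟩
  have e : MvPolynomial.eval (fun i => x i) ((∑ k ∈ Finset.range j,
      MvPolynomial.C ((-1) ^ k / ((2 * k + 1).factorial : ℝ)) *
      (MvPolynomial.C (t ^ 2) * ∑ i, MvPolynomial.X i ^ 2) ^ k) ^ M)
      = sincPartial j ((t * ‖x‖) ^ 2) ^ M := by
    rw [mul_pow, EuclideanSpace.real_norm_sq_eq]
    simp [sincPartial]
  rw [e]
  refine (abs_sinc_pow_sub_le M j _).trans ?_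
  rw [abs_mul, abs_norm, ← mul_assoc (2 * (M : ℝ)), ← mul_assoc]
  exact mul_le_mul_of_nonneg_right hj.le (exp_pos _).le

theorem abs_sinc_le_two_div (r : ℝ) (hr : 0 ≤ r) : |sinc r| ≤ 2 / (1 + r) := by
  rw [le_div_iff₀ (by positivity)]
  have h1 := abs_sinc_le_one r
  have h2 : |sinc r| * r ≤ 1 := by
    rcases hr.eq_or_lt with rfl | hr
    · simp
    · rw [sinc_of_ne_zero hr.ne', abs_div, abs_of_pos hr, div_mul_cancel₀ _ hr.ne']
      exact abs_sin_le_one r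
  linarith

/-- The exponent is even, to make the power nonnegative, and large enough that after multiplication
by 1 + ‖x‖ the decay is still of order 2n + 3 > n. -/
theorem integrable_sinc_moment (n : ℕ) :
    Integrable fun x : Rn n => (1 + ‖x‖) * sinc ‖x‖ ^ (2 * (n + 2)) := by
  have h := (integrable_one_add_norm (E := Rn n) (μ := volume) (r := ((2 * n + 3 : ℕ) : ℝ))
    (by simp; linarith)).const_mul (2 ^ (2 * (n + 2)) : ℝ)
  refine h.mono' ?_ (Eventually.of_forall fun x => ?_)
  · exact ((by fun_prop : Continuous fun x : Rn n => 1 + ‖x‖).mul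
      ((continuous_sinc.comp continuous_norm).pow _)).aestronglyMeasurable
  · have hx : 0 < 1 + ‖x‖ := by positivity
    rw [norm_mul, norm_pow, Real.norm_of_nonneg hx.le, Real.norm_eq_abs, rpow_neg hx.le,
      rpow_natCast]
    calc (1 + ‖x‖) * |sinc ‖x‖| ^ (2 * (n + 2))
        ≤ (1 + ‖x‖) * (2 / (1 + ‖x‖)) ^ (2 * (n + 2)) := by
          gcongr; exact abs_sinc_le_two_div _ (norm_nonneg _)
      _ = _ := by
          rw [show 2 * (n + 2) = 2 * n + 3 + 1 by ring, div_pow, pow_succ (1 + ‖x‖)]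
          field_simp

/-- A probability density on `ℝⁿ` which is entire of exponential type. -/
noncomputable def sincKernel (n : ℕ) (x : Rn n) : ℝ :=
  (∫ u : Rn n, sinc ‖u‖ ^ (2 * (n + 2)))⁻¹ * sinc ‖x‖ ^ (2 * (n + 2))

theorem continuous_sinc_norm_pow (n M : ℕ) : Continuous fun x : Rn n => sinc ‖x‖ ^ M :=
  (continuous_sinc.comp continuous_norm).pow _

theorem continuous_sincKernel (n : ℕ) : Continuous (sincKernel n) :=
  continuous_const.mul (continuous_sinc_norm_pow n _)

theorem sinc_pow_even_nonneg (n : ℕ) (x : Rn n) : 0 ≤ sinc ‖x‖ ^ (2 * (n + 2)) := by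
  rw [pow_mul]; positivity

theorem integrable_sinc_pow (n : ℕ) :
    Integrable fun x : Rn n => sinc ‖x‖ ^ (2 * (n + 2)) := by
  refine (integrable_sinc_moment n).mono' (continuous_sinc_norm_pow n _).aestronglyMeasurable
    (Eventually.of_forall fun x => ?_)
  have h := sinc_pow_even_nonneg n x
  rw [Real.norm_of_nonneg h]
  exact le_mul_of_one_le_left h (by linarith [norm_nonneg x])

theorem integral_sinc_pow_pos (n : ℕ) : 0 < ∫ u : Rn n, sinc ‖u‖ ^ (2 * (n + 2)) :=
  integral_pos_of_integrable_nonneg_nonzero (x := 0) (continuous_sinc_norm_pow n _)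
    (integrable_sinc_pow n) (sinc_pow_even_nonneg n) (by simp)

theorem sincKernel_nonneg (n : ℕ) (x : Rn n) : 0 ≤ sincKernel n x :=
  mul_nonneg (inv_nonneg.2 (integral_sinc_pow_pos n).le) (sinc_pow_even_nonneg n x)

theorem integrable_sincKernel (n : ℕ) : Integrable (sincKernel n) :=
  (integrable_sinc_pow n).const_mul _

theorem integral_sincKernel (n : ℕ) : ∫ x, sincKernel n x = 1 := by
  unfold sincKernel
  rw [integral_const_mul]
  exact inv_mul_cancel₀ (integral_sinc_pow_pos n).ne'

theorem integrable_norm_mul_sincKernel (n : ℕ) :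
    Integrable fun x => ‖x‖ * sincKernel n x := by
  refine ((integrable_sinc_moment n).const_mul
    (∫ u : Rn n, sinc ‖u‖ ^ (2 * (n + 2)))⁻¹).mono'
    (continuous_norm.mul (continuous_sincKernel n)).aestronglyMeasurable
    (Eventually.of_forall fun x => ?_)
  rw [Real.norm_of_nonneg (mul_nonneg (norm_nonneg x) (sincKernel_nonneg n x))]
  have h : (∫ u : Rn n, sinc ‖u‖ ^ (2 * (n + 2)))⁻¹ * ((1 + ‖x‖) * sinc ‖x‖ ^ (2 * (n + 2)))
      = (1 + ‖x‖) * sincKernel n x := by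
    unfold sincKernel; ring
  rw [h]
  have := sincKernel_nonneg n x
  gcongr
  linarith

/-- The rescaled kernels `tⁿ K(t x)`, which form an approximate identity as `t → ∞`. -/
noncomputable def scaledKernel (n : ℕ) (t : ℝ) (x : Rn n) : ℝ := t ^ n * sincKernel n (t • x)

theorem continuous_scaledKernel (n : ℕ) (t : ℝ) : Continuous (scaledKernel n t) :=
  continuous_const.mul ((continuous_sincKernel n).comp (continuous_const_smul t))

theorem exists_polynomial_approx_scaledKernel (n : ℕ) {t : ℝ} (ht : 0 < t) :
    ∃ a, 0 ≤ a ∧ ∀ ε > 0, ∃ P : MvPolynomial (Fin n) ℝ, ∀ x : Rn n,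
      |scaledKernel n t x - MvPolynomial.eval (fun i => x i) P| ≤ ε * exp (a * ‖x‖) := by
  obtain ⟨a, ha, h⟩ := exists_polynomial_approx_sinc n (2 * (n + 2)) t
  refine ⟨a, ha, fun ε hε => ?_⟩
  set c : ℝ := t ^ n * (∫ u : Rn n, sinc ‖u‖ ^ (2 * (n + 2)))⁻¹ with hc
  have hc0 : 0 < c := mul_pos (pow_pos ht n) (inv_pos.2 (integral_sinc_pow_pos n))
  obtain ⟨P, hP⟩ := h (ε / c) (by positivity)
  refine ⟨MvPolynomial.C c * P, fun x => ?_⟩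
  have e : scaledKernel n t x - MvPolynomial.eval (fun i => x i) (MvPolynomial.C c * P)
      = c * (sinc (t * ‖x‖) ^ (2 * (n + 2)) - MvPolynomial.eval (fun i => x i) P) := by
    rw [scaledKernel, sincKernel, norm_smul, Real.norm_of_nonneg ht.le, map_mul,
      MvPolynomial.eval_C, hc]
    ring
  rw [e, abs_mul, abs_of_pos hc0]
  calc c * _ ≤ c * (ε / c * exp (a * ‖x‖)) := by gcongr; exact hP x
    _ = ε * exp (a * ‖x‖) := by field_simp

end Kernel

/-! ### Convolution with a compactly supported function -/

section Convolution

variable {n : ℕ} {𝕜 : Type*} [RCLike 𝕜]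

/-- The convolution of a scalar kernel with a function. -/
noncomputable def kconv (k : Rn n → ℝ) (g : Rn n → 𝕜) : Rn n → 𝕜 :=
  convolution k g (ContinuousLinearMap.lsmul ℝ ℝ) volume

theorem kconv_apply (k : Rn n → ℝ) (g : Rn n → 𝕜) (x : Rn n) :
    kconv k g x = ∫ u, k u • g (x - u) := rfl

theorem integrable_kconv {k : Rn n → ℝ} (hk : Continuous k) {g : Rn n → 𝕜}
    (hg : Continuous g) (hs : HasCompactSupport g) (x : Rn n) :
    Integrable fun u => k u • g (x - u) :=
  hs.convolutionExists_right (ContinuousLinearMap.lsmul ℝ ℝ) hk.locallyIntegrable hg x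

/-- The derivative falls on g, so the kernel need only be continuous and may grow arbitrarily. -/
theorem partialDeriv_kconv {k : Rn n → ℝ} (hk : Continuous k) {g : Rn n → 𝕜}
    (hg : ContDiff ℝ ∞ g) (hs : HasCompactSupport g) (i : Fin n) :
    partialDeriv i (kconv k g) = kconv k (partialDeriv i g) := by
  funext x
  have h := hs.hasFDerivAt_convolution_right (ContinuousLinearMap.lsmul ℝ ℝ)
    (hk.locallyIntegrable (μ := volume)) (hg.of_le (by exact_mod_cast le_top)) x
  have h2 := convolution_precompR_apply (ContinuousLinearMap.lsmul ℝ ℝ)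
    (hk.locallyIntegrable (μ := volume)) (hs.fderiv ℝ) (hg.continuous_fderiv (by simp)) x
    (EuclideanSpace.single i 1)
  unfold partialDeriv kconv
  rw [h.fderiv, h2]

theorem wordDeriv_kconv {k : Rn n → ℝ} (hk : Continuous k) {g : Rn n → 𝕜}
    (hg : ContDiff ℝ ∞ g) (hs : HasCompactSupport g) (w : List (Fin n)) :
    wordDeriv w (kconv k g) = kconv k (wordDeriv w g) := by
  induction w with
  | nil => rfl
  | cons i w ih =>
    rw [wordDeriv_cons, ih, partialDeriv_kconv hk (contDiff_wordDeriv w hg)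
      (hasCompactSupport_wordDeriv w hs), wordDeriv_cons]

theorem kconv_sub {k l : Rn n → ℝ} (hk : Continuous k) (hl : Continuous l) {g : Rn n → 𝕜}
    (hg : Continuous g) (hs : HasCompactSupport g) :
    kconv (k - l) g = kconv k g - kconv l g := by
  funext x
  simp only [kconv_apply, Pi.sub_apply, sub_smul]
  exact integral_sub (integrable_kconv hk hg hs x) (integrable_kconv hl hg hs x)

/-- A kernel of exponential growth produces convolutions of exponential growth. -/
theorem exists_norm_kconv_le {g : Rn n → 𝕜} (hg : Continuous g) (hs : HasCompactSupport g)
    {a : ℝ} (ha : 0 ≤ a) :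
    ∃ C, 0 ≤ C ∧ ∀ ε ≥ 0, ∀ k : Rn n → ℝ, (∀ x, |k x| ≤ ε * exp (a * ‖x‖)) →
      ∀ x, ‖kconv k g x‖ ≤ ε * C * exp (a * ‖x‖) := by
  obtain ⟨R, hR⟩ := hs.isCompact.isBounded.exists_norm_le
  refine ⟨exp (a * R) * ∫ u, ‖g u‖, by positivity, fun ε hε k hk x => ?_⟩
  have hi : Integrable fun u => ‖g (x - u)‖ :=
    ((hg.integrable_of_hasCompactSupport hs).comp_sub_left x).norm
  calc ‖kconv k g x‖ ≤ ∫ u, ε * exp (a * R) * exp (a * ‖x‖) * ‖g (x - u)‖ := by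
        rw [kconv_apply]
        refine norm_integral_le_of_norm_le (hi.const_mul _) (Eventually.of_forall fun u => ?_)
        rw [norm_smul]
        -- Where g (x - u) does not vanish, ‖u‖ ≤ ‖x‖ + R; this produces the factor exp (a R).
        by_cases h : x - u ∈ tsupport g
        · gcongr
          refine (hk u).trans ?_
          rw [mul_assoc, ← exp_add, ← mul_add]
          gcongr
          have h1 := hR _ h
          have h2 := norm_sub_norm_le u x
          rw [norm_sub_rev] at h2
          linarith
        · rw [image_eq_zero_of_notMem_tsupport h]
          simp
    _ = ε * (exp (a * R) * ∫ u, ‖g u‖) * exp (a * ‖x‖) := by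
        rw [integral_const_mul, integral_sub_left_eq_self (fun u => ‖g u‖) volume x]
        ring

theorem kconv_scaledKernel_eq_integral {t : ℝ} (ht : 0 < t) (g : Rn n → 𝕜) (x : Rn n) :
    kconv (scaledKernel n t) g x = ∫ v, sincKernel n v • g (x - t⁻¹ • v) := by
  have h := Measure.integral_comp_smul_of_nonneg (volume : Measure (Rn n))
    (fun v => sincKernel n v • g (x - t⁻¹ • v)) t (hR := ht.le)
  simp only [inv_smul_smul₀ ht.ne'] at h
  rw [finrank_euclideanSpace_fin] at h
  simp only [kconv_apply, scaledKernel, mul_smul]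
  rw [integral_smul, h, smul_inv_smul₀ (pow_pos ht n).ne']

/-- Uniform continuity for ‖v‖ < t δ and boundedness elsewhere combine into a bound affine in ‖v‖,
which is integrated against the kernel using its finite first moment J. -/
theorem exists_norm_kconv_scaledKernel_sub_le {g : Rn n → 𝕜} (hg : Continuous g)
    (hs : HasCompactSupport g) {ε : ℝ} (hε : 0 < ε) :
    ∃ T > 0, ∀ t ≥ T, ∀ x, ‖kconv (scaledKernel n t) g x - g x‖ ≤ ε := by
  obtain ⟨M, hM⟩ := hs.exists_bound_of_continuous hg
  have hM0 : 0 ≤ M := (norm_nonneg _).trans (hM 0)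
  obtain ⟨δ, hδ, hu⟩ := Metric.uniformContinuous_iff.1
    (hs.uniformContinuous_of_continuous hg) (ε / 2) (by positivity)
  set J := ∫ v, ‖v‖ * sincKernel n v with hJ
  have hJ0 : 0 ≤ J := integral_nonneg fun v => mul_nonneg (norm_nonneg v) (sincKernel_nonneg n v)
  -- Chosen so that 2 M J / (t δ) ≤ ε / 2; the extra 1 keeps the threshold positive.
  refine ⟨(4 * M * J + 1) / (δ * ε), by positivity, fun t ht x => ?_⟩
  have ht0 : 0 < t := lt_of_lt_of_le (by positivity) ht
  have hpt : ∀ v, ‖g (x - t⁻¹ • v) - g x‖ ≤ ε / 2 + 2 * M / (t * δ) * ‖v‖ := by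
    intro v
    have e : dist (x - t⁻¹ • v) x = ‖v‖ / t := by
      rw [dist_eq_norm, sub_sub_cancel_left, norm_neg, norm_smul, norm_inv,
        Real.norm_of_nonneg ht0.le]
      ring
    by_cases h : dist (x - t⁻¹ • v) x < δ
    · have := hu h
      rw [dist_eq_norm] at this
      have h0 : 0 ≤ 2 * M / (t * δ) * ‖v‖ := by positivity
      linarith
    · rw [e, not_lt, le_div_iff₀ ht0] at h
      have h2 : 2 * M ≤ 2 * M / (t * δ) * ‖v‖ := by
        rw [div_mul_eq_mul_div, le_div_iff₀ (by positivity)]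
        gcongr
        linarith
      have := norm_sub_le (g (x - t⁻¹ • v)) (g x)
      linarith [hM (x - t⁻¹ • v), hM x]
  have hK := integrable_sincKernel n
  have hKg : Integrable fun v => sincKernel n v • g (x - t⁻¹ • v) :=
    hK.smul_of_top_left
      (memLp_top_of_bound (by fun_prop : Continuous fun v => g (x - t⁻¹ • v)).aestronglyMeasurable
        M (Eventually.of_forall fun v => hM _))
  have hsub : kconv (scaledKernel n t) g x - g x
      = ∫ v, sincKernel n v • (g (x - t⁻¹ • v) - g x) := by
    simp only [smul_sub]
    rw [integral_sub hKg (hK.smul_const _), integral_smul_const, integral_sincKernel, one_smul,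
      kconv_scaledKernel_eq_integral ht0]
  rw [hsub]
  have hint := (hK.const_mul (ε / 2)).add
    ((integrable_norm_mul_sincKernel n).const_mul (2 * M / (t * δ)))
  calc _ ≤ ∫ v, (ε / 2 * sincKernel n v + 2 * M / (t * δ) * (‖v‖ * sincKernel n v)) := by
        refine norm_integral_le_of_norm_le hint (Eventually.of_forall fun v => ?_)
        rw [norm_smul, Real.norm_of_nonneg (sincKernel_nonneg n v)]
        have := mul_le_mul_of_nonneg_left (hpt v) (sincKernel_nonneg n v)
        linarith
    _ = ε / 2 + 2 * M / (t * δ) * J := by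
        rw [integral_add (hK.const_mul _) ((integrable_norm_mul_sincKernel n).const_mul _),
          integral_const_mul, integral_const_mul, integral_sincKernel, mul_one]
    _ ≤ ε := by
        have : 2 * M / (t * δ) * J ≤ ε / 2 := by
          rw [div_mul_eq_mul_div, div_le_iff₀ (by positivity)]
          rw [ge_iff_le, div_le_iff₀ (by positivity)] at ht
          linarith
        linarith

end Convolution

/-! ### Polynomial functions: convolution, derivatives, growth -/

section Polynomials

variable {n : ℕ} {𝕜 : Type*} [RCLike 𝕜]

theorem continuous_polyFun (p : MvPolynomial (Fin n) 𝕜) : Continuous (polyFun p) := by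
  unfold polyFun
  exact (MvPolynomial.continuous_eval p).comp
    (continuous_pi fun i => RCLike.continuous_ofReal.comp (by fun_prop))

theorem polyFun_C (c : 𝕜) : polyFun (MvPolynomial.C c : MvPolynomial (Fin n) 𝕜) = fun _ => c := by
  funext x; simp [polyFun]

theorem polyFun_add (p q : MvPolynomial (Fin n) 𝕜) : polyFun (p + q) = polyFun p + polyFun q := by
  funext x; simp [polyFun]

theorem polyFun_mul_X (p : MvPolynomial (Fin n) 𝕜) (i : Fin n) :
    polyFun (p * MvPolynomial.X i) = fun x : Rn n => x i • polyFun p x := by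
  funext x; simp [polyFun, RCLike.real_smul_eq_coe_mul, mul_comm]

/-- Writing u_i = x_i - (x - u)_i, a factor u_i in the kernel becomes x_i times the convolution with
g, minus the convolution with y_i g. The induction therefore lets g vary. -/
theorem exists_kconv_eq_polyFun (P : MvPolynomial (Fin n) ℝ) {g : Rn n → 𝕜}
    (hg : Continuous g) (hs : HasCompactSupport g) :
    ∃ p : MvPolynomial (Fin n) 𝕜,
      kconv (fun x => MvPolynomial.eval (fun i => x i) P) g = polyFun p := by
  have hc : ∀ P : MvPolynomial (Fin n) ℝ,
      Continuous fun x : Rn n => MvPolynomial.eval (fun i => x i) P := continuous_polyFun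
  induction P using MvPolynomial.induction_on generalizing g with
  | C a =>
    refine ⟨MvPolynomial.C (a • ∫ u, g u), ?_⟩
    rw [polyFun_C]
    funext x
    simp only [kconv_apply, MvPolynomial.eval_C]
    rw [integral_smul, integral_sub_left_eq_self g volume x]
  | add P Q hP hQ =>
    obtain ⟨p, hp⟩ := hP hg hs
    obtain ⟨q, hq⟩ := hQ hg hs
    refine ⟨p + q, ?_⟩
    rw [polyFun_add, ← hp, ← hq]
    funext x
    simp only [kconv_apply, map_add, add_smul, Pi.add_apply]
    exact integral_add (integrable_kconv (hc P) hg hs x) (integrable_kconv (hc Q) hg hs x)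
  | mul_X P i hP =>
    have hi : Continuous fun y : Rn n => y i := by fun_prop
    have hg' : Continuous ((fun y : Rn n => y i) • g) := hi.smul hg
    have hs' : HasCompactSupport ((fun y : Rn n => y i) • g) := hs.smul_left
    obtain ⟨p, hp⟩ := hP hg hs
    obtain ⟨q, hq⟩ := hP hg' hs'
    refine ⟨p * MvPolynomial.X i + MvPolynomial.C (-1) * q, ?_⟩
    have e : polyFun (MvPolynomial.C (-1) * q) = -polyFun q := by
      funext x; simp [polyFun]
    rw [polyFun_add, polyFun_mul_X, e, ← hp, ← hq]
    funext x
    simp only [kconv_apply, Pi.add_apply, Pi.neg_apply, ← sub_eq_add_neg]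
    rw [← integral_smul]
    refine Eq.trans ?_ (integral_sub ((integrable_kconv (hc P) hg hs x).smul (x i))
      (integrable_kconv (hc P) hg' hs' x))
    congr 1
    funext u
    simp only [Pi.smul_apply', map_mul, MvPolynomial.eval_X, PiLp.sub_apply, smul_smul, ← sub_smul]
    congr 1
    ring

theorem contDiff_polyFun (p : MvPolynomial (Fin n) 𝕜) : ContDiff ℝ ∞ (polyFun p) := by
  induction p using MvPolynomial.induction_on with
  | C a => rw [polyFun_C]; exact contDiff_const
  | add p q hp hq => rw [polyFun_add]; exact hp.add hq
  | mul_X p i hp =>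
    rw [polyFun_mul_X]
    exact (by fun_prop : ContDiff ℝ ∞ fun x : Rn n => x i).smul hp

theorem partialDeriv_polyFun (i : Fin n) (p : MvPolynomial (Fin n) 𝕜) :
    ∃ q : MvPolynomial (Fin n) 𝕜, partialDeriv i (polyFun p) = polyFun q := by
  induction p using MvPolynomial.induction_on with
  | C a =>
    refine ⟨MvPolynomial.C 0, ?_⟩
    rw [polyFun_C, polyFun_C]
    funext x
    simp [partialDeriv]
  | add p q hp hq =>
    obtain ⟨p', hp⟩ := hp
    obtain ⟨q', hq⟩ := hq
    refine ⟨p' + q', ?_⟩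
    rw [polyFun_add, partialDeriv_add i (contDiff_polyFun p) (contDiff_polyFun q), hp, hq,
      polyFun_add]
  | mul_X p j hp =>
    obtain ⟨p', hp⟩ := hp
    have hj : ContDiff ℝ ∞ fun x : Rn n => x j := by fun_prop
    refine ⟨MvPolynomial.C (((EuclideanSpace.single i (1 : ℝ) : Rn n) j : ℝ) : 𝕜) * p
      + p' * MvPolynomial.X j, ?_⟩
    have h1 : polyFun (p * MvPolynomial.X j) = (fun x : Rn n => x j) • polyFun p := by
      rw [polyFun_mul_X]; rfl
    rw [h1, partialDeriv_smul i hj (contDiff_polyFun p), hp, polyFun_add, polyFun_mul_X]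
    have h2 : partialDeriv i (fun x : Rn n => x j)
        = fun _ => (EuclideanSpace.single i (1 : ℝ) : Rn n) j := by
      funext x
      have h3 : HasFDerivAt (fun x : Rn n => x j) (EuclideanSpace.proj j : Rn n →L[ℝ] ℝ) x :=
        (EuclideanSpace.proj j : Rn n →L[ℝ] ℝ).hasFDerivAt
      rw [partialDeriv, h3.fderiv]
      rfl
    rw [h2]
    funext x
    by_cases hij : j = i <;> simp [polyFun, RCLike.real_smul_eq_coe_mul, hij]

theorem wordDeriv_polyFun (w : List (Fin n)) (p : MvPolynomial (Fin n) 𝕜) :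
    ∃ q : MvPolynomial (Fin n) 𝕜, wordDeriv w (polyFun p) = polyFun q := by
  induction w with
  | nil => exact ⟨p, rfl⟩
  | cons i w ih =>
    obtain ⟨q, hq⟩ := ih
    rw [wordDeriv_cons, hq]
    exact partialDeriv_polyFun i q

theorem norm_polyFun_le (p : MvPolynomial (Fin n) 𝕜) :
    ∃ C a : ℝ, 0 ≤ C ∧ 0 ≤ a ∧ ∀ x, ‖polyFun p x‖ ≤ C * exp (a * ‖x‖) := by
  induction p using MvPolynomial.induction_on with
  | C c => exact ⟨‖c‖, 0, norm_nonneg _, le_rfl, fun x => by simp [polyFun_C]⟩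
  | add p q hp hq =>
    obtain ⟨C, a, hC, ha, hp⟩ := hp
    obtain ⟨D, b, hD, hb, hq⟩ := hq
    refine ⟨C + D, max a b, by positivity, le_max_of_le_left ha, fun x => ?_⟩
    rw [polyFun_add, add_mul]
    refine (norm_add_le _ _).trans (add_le_add ((hp x).trans ?_) ((hq x).trans ?_))
    · gcongr; exact le_max_left _ _
    · gcongr; exact le_max_right _ _
  | mul_X p i hp =>
    obtain ⟨C, a, hC, ha, hp⟩ := hp
    refine ⟨C, a + 1, hC, by positivity, fun x => ?_⟩
    rw [polyFun_mul_X, norm_smul, add_mul, exp_add, one_mul]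
    have h1 : ‖x i‖ ≤ exp ‖x‖ :=
      (PiLp.norm_apply_le x i).trans (by linarith [add_one_le_exp ‖x‖])
    calc ‖x i‖ * ‖polyFun p x‖ ≤ exp ‖x‖ * (C * exp (a * ‖x‖)) := by gcongr; exact hp x
      _ = _ := by ring

end Polynomials

/-! ### Weight estimates, cutoff and density -/

section Approximation

variable {n : ℕ} {𝕜 : Type*} [RCLike 𝕜]

theorem exists_lower_bound_of_eventually_cocompact {g : Rn n → ℝ} (hg : Continuous g)
    (h : ∀ᶠ x in cocompact (Rn n), 0 ≤ g x) : ∃ C, ∀ x, 0 ≤ g x + C := by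
  obtain ⟨K, hK, hKg⟩ := mem_cocompact.1 h
  obtain ⟨b, hb⟩ := (hK.image hg).bddBelow
  refine ⟨max (-b) 0, fun x => ?_⟩
  by_cases hx : x ∈ K
  · linarith [hb ⟨x, hx, rfl⟩, le_max_left (-b) 0]
  · have : 0 ≤ g x := hKg hx
    linarith [le_max_right (-b) 0]

theorem exists_mul_norm_le_add {w : Rn n → ℝ} (hw : Continuous w)
    (h : Tendsto (fun x => w x / ‖x‖) (cocompact (Rn n)) atTop) (a : ℝ) :
    ∃ C, ∀ x, a * ‖x‖ ≤ w x + C := by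
  obtain ⟨C, hC⟩ := exists_lower_bound_of_eventually_cocompact (g := fun x => w x - a * ‖x‖)
    (by fun_prop) (by
      -- The lower bound 1 rules out x = 0, where the quotient is 0 by convention.
      filter_upwards [h.eventually_ge_atTop (max a 1)] with x hx
      have hx0 : 0 < ‖x‖ := by
        refine (norm_nonneg x).lt_of_ne fun h0 => ?_
        rw [← h0, div_zero] at hx
        linarith [le_max_right a 1]
      have := (le_div_iff₀ hx0).1 ((le_max_left a 1).trans hx)
      linarith)
  exact ⟨C, fun x => by linarith [hC x]⟩

/-- Up to constants the weights decrease with m, so an estimate for the order M controls all orders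
m ≤ M. -/
theorem exists_le_add_of_le {φ : ℕ+ → Rn n → ℝ} (hφ : ∀ m, Continuous (φ m))
    (h2 : ∀ m, Tendsto (fun x => φ m x - φ (m + 1) x) (cocompact (Rn n)) atTop) (M : ℕ+) :
    ∃ C, ∀ m ≤ M, ∀ x, φ M x ≤ φ m x + C := by
  induction M using PNat.recOn with
  | one => exact ⟨0, fun m hm x => by rw [le_antisymm hm one_le, add_zero]⟩
  | succ M ih =>
    obtain ⟨C, hC⟩ := ih
    obtain ⟨D, hD⟩ := exists_lower_bound_of_eventually_cocompact
      ((hφ M).sub (hφ (M + 1))) ((h2 M).eventually_ge_atTop 0)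
    refine ⟨max (C + D) 0, fun m hm x => ?_⟩
    rcases hm.lt_or_eq with hm | rfl
    · have h3 := hC m (PNat.lt_add_one_iff.1 hm) x
      have h4 := hD x
      simp only [Pi.sub_apply] at h4
      linarith [le_max_left (C + D) 0]
    · linarith [le_max_right (C + D) 0]

theorem mem_weightedSubmodule_of_mem_projSubmodule {φ : ℕ+ → Rn n → ℝ} {f : Rn n → 𝕜}
    (hf : f ∈ projSubmodule 𝕜 φ) (m : ℕ+) : f ∈ weightedSubmodule 𝕜 m (φ m) :=
  (Submodule.mem_iInf _).1 hf m

theorem contDiff_of_mem_projSubmodule {φ : ℕ+ → Rn n → ℝ} {f : Rn n → 𝕜}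
    (hf : f ∈ projSubmodule 𝕜 φ) : ContDiff ℝ ∞ f := by
  rw [contDiff_infty]
  intro k
  refine (mem_weightedSubmodule_of_mem_projSubmodule hf k.succPNat).1.of_le ?_
  exact_mod_cast Nat.le_succ k

theorem exists_norm_wordDeriv_le {m : ℕ} {w : Rn n → ℝ} {f : Rn n → 𝕜}
    (hf : f ∈ weightedSubmodule 𝕜 m w) (hs : ContDiff ℝ ∞ f) :
    ∃ C, 0 ≤ C ∧ ∀ v : List (Fin n), v.length ≤ m → ∀ x, ‖wordDeriv v f x‖ ≤ C * exp (w x) := by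
  obtain ⟨-, C, hC⟩ := hf
  refine ⟨max C 0, le_max_right _ _, fun v hv x => ?_⟩
  obtain ⟨α, hα, hd⟩ := exists_multiDeriv_eq_wordDeriv v hs
  rw [hd, ← div_le_iff₀ (exp_pos _)]
  exact (hC α (hα.trans_le hv) x).trans (le_max_left _ _)

theorem weightedSup_le_of_wordDeriv {m : ℕ} {w : Rn n → ℝ} {f : Rn n → 𝕜} {ε : ℝ}
    (h : ∀ v : List (Fin n), v.length ≤ m → ∀ x, ‖wordDeriv v f x‖ ≤ ε * exp (w x)) :
    weightedSup m w f ≤ ε := by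
  refine weightedSup_le fun α hα x => ?_
  rw [multiDeriv_eq_wordDeriv, div_le_iff₀ (exp_pos _)]
  exact h _ ((length_indexWord α).trans_le hα) x

theorem polyFun_mem_projSubmodule {φ : ℕ+ → Rn n → ℝ} (hφ : ∀ m, Continuous (φ m))
    (h1 : ∀ m, Tendsto (fun x => φ m x / ‖x‖) (cocompact (Rn n)) atTop)
    (p : MvPolynomial (Fin n) 𝕜) : polyFun p ∈ projSubmodule 𝕜 φ := by
  refine (Submodule.mem_iInf _).2 fun m => ⟨(contDiff_polyFun p).of_le
    (by exact_mod_cast le_top), ?_⟩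
  have h : ∀ v : List (Fin n), ∃ C, ∀ x, ‖wordDeriv v (polyFun p) x‖ ≤ C * exp (φ m x) := by
    intro v
    obtain ⟨q, hq⟩ := wordDeriv_polyFun v p
    obtain ⟨C, a, hC, -, hb⟩ := norm_polyFun_le q
    obtain ⟨D, hD⟩ := exists_mul_norm_le_add (hφ m) (h1 m) a
    refine ⟨C * exp D, fun x => ?_⟩
    rw [hq]
    refine (hb x).trans ?_
    rw [mul_assoc, ← exp_add]
    gcongr
    linarith [hD x]
  choose C hC using h
  obtain ⟨B, hB⟩ := ((finite_words (n := n) m).image C).bddAbove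
  refine ⟨B, fun α hα x => ?_⟩
  rw [multiDeriv_eq_wordDeriv]
  refine le_trans ?_ (hB ⟨indexWord α, (length_indexWord α).trans_le hα, rfl⟩)
  rw [div_le_iff₀ (exp_pos _)]
  exact hC _ x

theorem exists_compactly_supported_approx {φ : ℕ+ → Rn n → ℝ}
    (h2 : ∀ m, Tendsto (fun x => φ m x - φ (m + 1) x) (cocompact (Rn n)) atTop)
    {f : Rn n → 𝕜} (hf : f ∈ projSubmodule 𝕜 φ) (m : ℕ+) {ε : ℝ} (hε : 0 < ε) :
    ∃ g : Rn n → 𝕜, ContDiff ℝ ∞ g ∧ HasCompactSupport g ∧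
      ∀ w : List (Fin n), w.length ≤ m → ∀ x, ‖wordDeriv w (f - g) x‖ ≤ ε * exp (φ m x) := by
  have hfs := contDiff_of_mem_projSubmodule hf
  let χ : ContDiffBump (0 : Rn n) := ⟨1, 2, one_pos, one_lt_two⟩
  have hχ : ContDiff ℝ ∞ (χ : Rn n → ℝ) := χ.contDiff
  obtain ⟨A, hA, hχA⟩ := exists_bound_wordDeriv m hχ χ.hasCompactSupport
  obtain ⟨C, hC, hfC⟩ := exists_norm_wordDeriv_le
    (mem_weightedSubmodule_of_mem_projSubmodule hf (m + 1)) hfs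
  -- The 1 accounts for f itself, the term 2^m A for the Leibniz bound on the cutoff product.
  set D : ℝ := (1 + 2 ^ (m : ℕ) * A) * C with hD
  have hlim : Tendsto (fun x => D * exp (-(φ m x - φ (m + 1) x))) (cocompact (Rn n)) (𝓝 0) := by
    simpa using (tendsto_exp_neg_atTop_nhds_zero.comp (h2 m)).const_mul D
  obtain ⟨R, hR⟩ : ∃ R : ℝ, ∀ x : Rn n, R ≤ ‖x‖ → D * exp (-(φ m x - φ (m + 1) x)) ≤ ε := by
    have h := hlim.eventually_le_const hε
    rw [← Metric.cobounded_eq_cocompact, ← comap_norm_atTop, eventually_comap] at h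
    obtain ⟨R, hR⟩ := eventually_atTop.1 h
    exact ⟨R, fun x hx => hR _ hx x rfl⟩
  -- The dilated cutoff equals 1 on ‖x‖ < max R 1, and r ≤ 1 keeps its derivatives bounded by the
  -- same A.
  set r : ℝ := (max R 1)⁻¹ with hr
  have hr0 : 0 < r := by positivity
  have hr1 : r ≤ 1 := inv_le_one_of_one_le₀ (le_max_right _ _)
  have hrR : ∀ x : Rn n, ‖x‖ < max R 1 → ‖r • x‖ < 1 := by
    intro x hx
    rw [norm_smul, Real.norm_of_nonneg hr0.le, hr, inv_mul_lt_iff₀ (by positivity), mul_one]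
    exact hx
  have hcs : ContDiff ℝ ∞ fun x : Rn n => χ (r • x) := hχ.comp (by fun_prop)
  have hgs : ContDiff ℝ ∞ ((fun x : Rn n => χ (r • x)) • f) := hcs.smul hfs
  refine ⟨(fun x => χ (r • x)) • f, hgs, ?_, fun w hw x => ?_⟩
  · exact (χ.hasCompactSupport.comp_smul hr0.ne').smul_right
  rcases lt_or_ge ‖x‖ (max R 1) with hx | hx
  · have hev : (f - (fun x : Rn n => χ (r • x)) • f) =ᶠ[𝓝 x] f - f := by
      filter_upwards [continuous_norm.continuousAt.eventually_lt continuousAt_const hx] with y hy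
      have : χ (r • y) = 1 := χ.one_of_mem_closedBall (by simpa using (hrR y hy).le)
      simp [this]
    rw [(wordDeriv_eventuallyEq w hev).eq_of_nhds, wordDeriv_sub w hfs hfs, sub_self,
      Pi.zero_apply, norm_zero]
    positivity
  · have hB : ∀ v : List (Fin n), v.length ≤ m →
        ‖wordDeriv v f x‖ ≤ C * exp (φ (m + 1) x) := fun v hv =>
      hfC v (hv.trans (by simp)) x
    have hc : ∀ v : List (Fin n), v.length ≤ w.length →
        ‖wordDeriv v (fun x : Rn n => χ (r • x)) x‖ ≤ A := by
      intro v hv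
      rw [wordDeriv_comp_smul v r hχ, norm_smul, norm_pow, Real.norm_of_nonneg hr0.le]
      refine (mul_le_of_le_one_left (norm_nonneg _) (pow_le_one₀ hr0.le hr1)).trans ?_
      exact hχA v (hv.trans hw) _
    have h3 := norm_wordDeriv_smul_le hA w hcs hfs hc (fun v hv => hB v (hv.trans hw))
    rw [wordDeriv_sub w hfs hgs, Pi.sub_apply]
    calc _ ≤ C * exp (φ (m + 1) x) + 2 ^ (m : ℕ) * (A * (C * exp (φ (m + 1) x))) := by
          refine (norm_sub_le _ _).trans (add_le_add (hB w hw) (h3.trans ?_))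
          gcongr
          exact one_le_two
      _ = D * exp (-(φ m x - φ (m + 1) x)) * exp (φ m x) := by
          rw [mul_assoc D, ← exp_add, hD]
          ring_nf
      _ ≤ ε * exp (φ m x) := by
          gcongr
          exact hR x ((le_max_left _ _).trans hx)

/-- The order of choices matters: t is fixed first, for all words at once; it determines the growth
rate a, and only then is the polynomial accuracy chosen. -/
theorem exists_polyFun_approx_of_hasCompactSupport {φ : Rn n → ℝ} (hφ : Continuous φ)
    (h1 : Tendsto (fun x => φ x / ‖x‖) (cocompact (Rn n)) atTop) {g : Rn n → 𝕜}
    (hg : ContDiff ℝ ∞ g) (hs : HasCompactSupport g) (m : ℕ) {ε : ℝ} (hε : 0 < ε) :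
    ∃ p : MvPolynomial (Fin n) 𝕜, ∀ w : List (Fin n), w.length ≤ m → ∀ x,
      ‖wordDeriv w (g - polyFun p) x‖ ≤ ε * exp (φ x) := by
  have hgw : ∀ w, Continuous (wordDeriv w g) := fun w => (contDiff_wordDeriv w hg).continuous
  have hsw : ∀ w, HasCompactSupport (wordDeriv w g) := fun w => hasCompactSupport_wordDeriv w hs
  -- With slope 0 this is just a lower bound: φ ≥ -B.
  obtain ⟨B, hB⟩ := exists_mul_norm_le_add hφ h1 0
  have hδ : 0 < ε / 2 * exp (-B) := by positivity
  choose T hT0 hT using fun w => exists_norm_kconv_scaledKernel_sub_le (hgw w) (hsw w) hδ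
  obtain ⟨t', ht'⟩ := ((finite_words (n := n) m).image T).bddAbove
  set t := max t' 1 with ht
  have ht0 : 0 < t := by positivity
  obtain ⟨a, ha, hP⟩ := exists_polynomial_approx_scaledKernel n ht0
  choose S hS0 hS using fun w => exists_norm_kconv_le (hgw w) (hsw w) ha
  obtain ⟨C', hC'⟩ := ((finite_words (n := n) m).image S).bddAbove
  set C := max C' 1 with hC
  have hC0 : 0 < C := by positivity
  obtain ⟨D, hD⟩ := exists_mul_norm_le_add hφ h1 a
  obtain ⟨P, hPK⟩ := hP (ε / 2 * exp (-D) / C) (by positivity)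
  obtain ⟨p, hp⟩ := exists_kconv_eq_polyFun P hg.continuous hs
  have hPc : Continuous fun x : Rn n => MvPolynomial.eval (fun i => x i) P := continuous_polyFun P
  have hKc := continuous_scaledKernel n t
  refine ⟨p, fun w hw x => ?_⟩
  rw [wordDeriv_sub w hg (contDiff_polyFun p), ← hp, wordDeriv_kconv hPc hg hs]
  have e1 : ‖kconv (scaledKernel n t) (wordDeriv w g) x - wordDeriv w g x‖
      ≤ ε / 2 * exp (φ x) := by
    refine (hT w t ((ht' ⟨w, hw, rfl⟩).trans (le_max_left _ _)) x).trans ?_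
    gcongr
    linarith [hB x]
  have e2 : ‖kconv (scaledKernel n t) (wordDeriv w g) x
      - kconv (fun x => MvPolynomial.eval (fun i => x i) P) (wordDeriv w g) x‖
      ≤ ε / 2 * exp (φ x) := by
    rw [← Pi.sub_apply, ← kconv_sub hKc hPc (hgw w) (hsw w)]
    refine (hS w (ε / 2 * exp (-D) / C) (by positivity) _ hPK x).trans ?_
    have hSC : S w ≤ C := (hC' ⟨w, hw, rfl⟩).trans (le_max_left _ _)
    calc ε / 2 * exp (-D) / C * S w * exp (a * ‖x‖)
        ≤ ε / 2 * exp (-D) / C * C * exp (φ x + D) := by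
          gcongr
          exact hD x
      _ = ε / 2 * exp (φ x) := by
          rw [div_mul_cancel₀ _ hC0.ne', mul_assoc, ← exp_add]
          ring_nf
  rw [Pi.sub_apply, ← norm_sub_rev]
  calc _ = ‖(kconv (scaledKernel n t) (wordDeriv w g) x - wordDeriv w g x)
        - (kconv (scaledKernel n t) (wordDeriv w g) x
          - kconv (fun x => MvPolynomial.eval (fun i => x i) P) (wordDeriv w g) x)‖ := by
        congr 1; abel
    _ ≤ ε / 2 * exp (φ x) + ε / 2 * exp (φ x) := (norm_sub_le _ _).trans (add_le_add e1 e2)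
    _ = ε * exp (φ x) := by ring

theorem exists_weightedSup_sub_polyFun_le {φ : ℕ+ → Rn n → ℝ} (hφ : ∀ m, Continuous (φ m))
    (h1 : ∀ m, Tendsto (fun x => φ m x / ‖x‖) (cocompact (Rn n)) atTop)
    (h2 : ∀ m, Tendsto (fun x => φ m x - φ (m + 1) x) (cocompact (Rn n)) atTop)
    {f : Rn n → 𝕜} (hf : f ∈ projSubmodule 𝕜 φ) (M : ℕ+) {ε : ℝ} (hε : 0 < ε) :
    ∃ p : MvPolynomial (Fin n) 𝕜, ∀ m ≤ M, weightedSup m (φ m) (f - polyFun p) ≤ ε := by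
  obtain ⟨C, hC⟩ := exists_le_add_of_le hφ h2 M
  have hδ : 0 < ε / 2 * exp (-C) := by positivity
  obtain ⟨g, hg, hs, hfg⟩ := exists_compactly_supported_approx h2 hf M hδ
  obtain ⟨p, hp⟩ := exists_polyFun_approx_of_hasCompactSupport (hφ M) (h1 M) hg hs M hδ
  refine ⟨p, fun m hm => weightedSup_le_of_wordDeriv fun w hw x => ?_⟩
  have hwM : w.length ≤ M := hw.trans (by exact_mod_cast hm)
  have hfs := contDiff_of_mem_projSubmodule hf
  have hps := contDiff_polyFun p
  rw [← sub_add_sub_cancel f g (polyFun p), wordDeriv_add w (f := f - g) (g := g - polyFun p)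
    (hfs.sub hg) (hg.sub hps)]
  calc _ ≤ ε / 2 * exp (-C) * exp (φ M x) + ε / 2 * exp (-C) * exp (φ M x) :=
        (norm_add_le _ _).trans (add_le_add (hfg w hwM x) (hp w hwM x))
    _ = ε * exp (-C + φ M x) := by rw [exp_add]; ring
    _ ≤ ε * exp (φ m x) := by
        gcongr
        linarith [hC m hm x]

theorem tendsto_weightedSpace_of_weightedSup {m : ℕ} {w : Rn n → ℝ} {ι : Type*} {l : Filter ι}
    {u : ι → WeightedSpace 𝕜 m w} {f : WeightedSpace 𝕜 m w}
    (h : Tendsto (fun k => weightedSup m w (f.1 - (u k).1)) l (𝓝 0)) : Tendsto u l (𝓝 f) := by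
  let _ := (weightedNorm (𝕜 := 𝕜) m w).toNormedAddCommGroup
  refine tendsto_iff_norm_sub_tendsto_zero.2 (h.congr fun k => ?_)
  rw [norm_sub_rev]
  rfl

theorem dense_polyFun {φ : ℕ+ → Rn n → ℝ} (hφ : ∀ m, Continuous (φ m))
    (h1 : ∀ m, Tendsto (fun x => φ m x / ‖x‖) (cocompact (Rn n)) atTop)
    (h2 : ∀ m, Tendsto (fun x => φ m x - φ (m + 1) x) (cocompact (Rn n)) atTop) :
    Dense {f : ProjSpace 𝕜 φ | ∃ p : MvPolynomial (Fin n) 𝕜, f.1 = polyFun p} := by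
  intro f
  -- The k-th polynomial is within 1/(k+1) in all orders up to k + 1, so one sequence converges in
  -- every q_m.
  choose p hp using fun k : ℕ => exists_weightedSup_sub_polyFun_le hφ h1 h2 f.2 k.succPNat
    (Nat.one_div_pos_of_nat (n := k) (α := ℝ))
  let u : ℕ → ProjSpace 𝕜 φ := fun k => ⟨polyFun (p k), polyFun_mem_projSubmodule hφ h1 (p k)⟩
  refine mem_closure_of_tendsto (f := u) (b := atTop) ?_ (Eventually.of_forall fun k => ⟨p k, rfl⟩)
  rw [nhds_iInf, tendsto_iInf]
  intro m
  rw [nhds_induced, tendsto_comap_iff]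
  refine tendsto_weightedSpace_of_weightedSup ?_
  refine squeeze_zero' (Eventually.of_forall fun k => Real.iSup_nonneg fun _ => by positivity) ?_
    tendsto_one_div_add_atTop_nhds_zero_nat
  filter_upwards [eventually_ge_atTop (m : ℕ)] with k hk
  exact hp k m (PNat.coe_le_coe _ _ |>.1 (by simpa using hk.trans (Nat.le_succ k)))

end Approximation

end WeightedApprox

theorem theorem1 {𝕜 : Type*} [RCLike 𝕜] (n : ℕ)
    (φ : ℕ+ → EuclideanSpace ℝ (Fin n) → ℝ)
    (hφ : ∀ m : ℕ+, Continuous (φ m))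
    (h1 : ∀ m : ℕ+, Tendsto (fun x => φ m x / ‖x‖) (cocompact (EuclideanSpace ℝ (Fin n))) atTop)
    (h2 : ∀ m : ℕ+, Tendsto (fun x => φ m x - φ (m + 1) x)
      (cocompact (EuclideanSpace ℝ (Fin n))) atTop) :
    (∀ p : MvPolynomial (Fin n) 𝕜, WeightedApprox.polyFun p ∈ WeightedApprox.projSubmodule 𝕜 φ) ∧
    Dense {f : WeightedApprox.ProjSpace 𝕜 φ |
      ∃ p : MvPolynomial (Fin n) 𝕜, f.1 = WeightedApprox.polyFun p} := by
  exact ⟨WeightedApprox.polyFun_mem_projSubmodule hφ h1, WeightedApprox.dense_polyFun hφ h1 h2⟩
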